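/- Let $I$ be a natural number, let $\Delta=\{P=(p_{i,j})\in\mathbb R^{I\times I}: p_{i,j}\ge 0,\ \sum_{i,j}p_{i,j}=1\}$, and let the diagonal-effect (quasi-independence) model $\mathcal M_1\subseteq\Delta$ be the set of all $P\in\Delta$ for which there are vectors $\zeta^{(r)},\zeta^{(c)},\zeta^{(\gamma)}\in\mathbb R_{\ge 0}^I$ with $$p_{i,j}=\zeta^{(r)}_i\zeta^{(c)}_j\quad (i\neq j),\qquad p_{i,i}=\zeta^{(r)}_i\zeta^{(c)}_i\zeta^{(\gamma)}_i .$$ Let $\mathbb R[p]$ be the polynomial ring in the $I^2$ indeterminates $p_{i,j}$. The toric ideal $\mathcal I$ of $\mathcal M_1$ is the ideal of all polynomial relations among the power products above, i.e. the kernel of the $\mathbb R$-algebra homomorphism $\mathbb R[p]\to\mathbb R[\zeta^{(r)},\zeta^{(c)},\zeta^{(\gamma)}]$ with $p_{i,j}\mapsto\zeta^{(r)}_i\zeta^{(c)}_j$ for $i\ne j$ and $p_{i,i}\mapsto\zeta^{(r)}_i\zeta^{(c)}_i\zeta^{(\gamma)}_i$. Let $B$ be the set of the binomials $$p_{i,j}p_{i',j'}-p_{i,j'}p_{i',j}\quad\text{for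 } i,i',j,j'\in\{1,\dots,I\} \text{ all distinct, and}$$ $$p_{i,i'}p_{i',i''}p_{i'',i}-p_{i,i''}p_{i'',i'}p_{i',i}\quad\text{for } i,i',i''\in\{1,\dots,I\} \text{ all distinct.}$$ Then $B$ generates the invariants of $\mathcal M_1$, in the following two senses. 1. $B$ generates the toric ideal: $\mathcal I=\langle B\rangle$. 2. The ideal of all polynomials in $\mathbb R[p]$ that vanish at every point of $\mathcal M_1$ is generated by $B$ together with the normalization $\sum_{i,j}p_{i,j}-1$ that holds on all of $\Delta$. -/

import Mathlib

/-- The polynomial with real coefficients `∏ ζ_h ^ A_{c,h}`: the power product by which a toric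
model with exponent matrix `A` parametrises the cell `c`. -/
noncomputable def powerProduct {C H : Type*} [Fintype H] (A : Matrix C H ℕ) (c : C) :
    MvPolynomial H ℝ :=
  ∏ h, MvPolynomial.X h ^ A c h

/-- The toric ideal of `A`: all polynomial relations among the power products, that is, the
kernel of the substitution `p_c ↦ ∏ ζ_h ^ A_{c,h}` from `ℝ[p]` to `ℝ[ζ]`. -/
noncomputable def toricIdeal {C H : Type*} [Fintype H] (A : Matrix C H ℕ) :
    Ideal (MvPolynomial C ℝ) :=
  RingHom.ker (MvPolynomial.aeval (R := ℝ) (powerProduct A))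

/-- The parameters of the diagonal-effect model for `n × n` tables, in this order: the row
parameters, the column parameters and the diagonal parameters. -/
abbrev DiagonalEffectParam (n : ℕ) : Type := Fin n ⊕ Fin n ⊕ Fin n

/-- The exponent matrix of the diagonal-effect model: the cell `(i, j)` contains the row
parameter `i` once, the column parameter `j` once and, exactly if `i = j`, the diagonal
parameter `i` once. -/
def diagonalEffectMatrix (n : ℕ) : Matrix (Fin n × Fin n) (DiagonalEffectParam n) ℕ :=
  fun c h => match h with
    | Sum.inl k => if c.1 = k then 1 else 0
    | Sum.inr (Sum.inl k) => if c.2 = k then 1 else 0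
    | Sum.inr (Sum.inr k) => if c.1 = k ∧ c.2 = k then 1 else 0

/-- The diagonal-effect (quasi-independence) model in toric form, a set of probability tables. -/
def diagonalEffectModel (n : ℕ) : Set (Fin n × Fin n → ℝ) :=
  {p | p ∈ stdSimplex ℝ (Fin n × Fin n) ∧
    ∃ r c γ : Fin n → ℝ, (∀ i, 0 ≤ r i) ∧ (∀ i, 0 ≤ c i) ∧ (∀ i, 0 ≤ γ i) ∧
      (∀ i j, i ≠ j → p (i, j) = r i * c j) ∧
      (∀ i, p (i, i) = r i * c i * γ i)}

/-- The binomials `p_{ij} p_{i'j'} - p_{ij'} p_{i'j}` with `i, i', j, j'` all distinct. -/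
def quadraticBinomials (n : ℕ) : Set (MvPolynomial (Fin n × Fin n) ℝ) :=
  {f | ∃ i i' j j' : Fin n, [i, i', j, j'].Nodup ∧
    f = MvPolynomial.X (i, j) * MvPolynomial.X (i', j') -
      MvPolynomial.X (i, j') * MvPolynomial.X (i', j)}

/-- The binomials `p_{ii'} p_{i'i''} p_{i''i} - p_{ii''} p_{i''i'} p_{i'i}` with `i, i', i''`
all distinct. -/
def cubicBinomials (n : ℕ) : Set (MvPolynomial (Fin n × Fin n) ℝ) :=
  {f | ∃ i i' i'' : Fin n, [i, i', i''].Nodup ∧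
    f = MvPolynomial.X (i, i') * MvPolynomial.X (i', i'') * MvPolynomial.X (i'', i) -
      MvPolynomial.X (i, i'') * MvPolynomial.X (i'', i') * MvPolynomial.X (i', i)}

open MvPolynomial

/-! The toric ideal lies in an ideal `J` as soon as monomials with equal image agree modulo `J`
(`toricIdeal_le_of_monomial`). Here equal image means equal row margins, column margins and
diagonal. For `J` spanned by the binomials, this becomes a statement about any family `y` in a
commutative monoid satisfying the quadratic and cubic relations: such tables have equal `y`-products
(`prod_map_eq_of_margins`). Induction on the size cancels a common cell; `exists_marginEquiv_cons`
creates one by moves.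

For the second part, homogenize modulo the normalization. Every table with positive parameters is a
multiple of a point of the model, so a homogeneous polynomial vanishing on the model vanishes on all
such tables, which forces it into the toric ideal. -/

/-- Two multisets of cells have the same row margins, the same column margins and the same diagonal
entries, and the products of `y` over them agree. -/
def MarginEquiv {α R : Type*} [DecidableEq α] [CommMonoid R] (y : α × α → R)
    (s t : Multiset (α × α)) : Prop :=
  s.map Prod.fst = t.map Prod.fst ∧ s.map Prod.snd = t.map Prod.snd ∧
    (∀ i, s.count (i, i) = t.count (i, i)) ∧ (s.map y).prod = (t.map y).prod

/-! ### Exchange moves on tables -/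

section Exchange

variable {α R : Type*} [DecidableEq α] [CommMonoid R] {y : α × α → R}

theorem MarginEquiv.trans {s t u : Multiset (α × α)} (h : MarginEquiv y s t)
    (h' : MarginEquiv y t u) : MarginEquiv y s u :=
  ⟨h.1.trans h'.1, h.2.1.trans h'.2.1, fun i => (h.2.2.1 i).trans (h'.2.2.1 i),
    h.2.2.2.trans h'.2.2.2⟩

theorem exists_eq_cons_cons {β : Type*} {s : Multiset β} {x x' : β} (hx : x ∈ s) (hx' : x' ∈ s)
    (h : x ≠ x') : ∃ u, s = x ::ₘ x' ::ₘ u := by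
  obtain ⟨u, rfl⟩ := Multiset.exists_cons_of_mem hx
  obtain ⟨w, rfl⟩ := Multiset.exists_cons_of_mem ((Multiset.mem_cons.1 hx').resolve_left h.symm)
  exact ⟨w, rfl⟩

theorem exists_eq_cons_cons_cons {β : Type*} {s : Multiset β} {x x' x'' : β} (hx : x ∈ s)
    (hx' : x' ∈ s) (hx'' : x'' ∈ s) (h : x ≠ x') (h' : x ≠ x'') (h'' : x' ≠ x'') :
    ∃ u, s = x ::ₘ x' ::ₘ x'' ::ₘ u := by
  obtain ⟨u, rfl⟩ := Multiset.exists_cons_of_mem hx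
  obtain ⟨w, rfl⟩ := exists_eq_cons_cons ((Multiset.mem_cons.1 hx').resolve_left h.symm)
    ((Multiset.mem_cons.1 hx'').resolve_left h'.symm) h''
  exact ⟨w, rfl⟩

theorem nodup_three {β : Type*} {a b c : β} (hab : a ≠ b) (hac : a ≠ c) (hbc : b ≠ c) :
    [a, b, c].Nodup := by simp [*]

theorem nodup_four {β : Type*} {a b c d : β} (hab : a ≠ b) (hac : a ≠ c) (had : a ≠ d)
    (hbc : b ≠ c) (hbd : b ≠ d) (hcd : c ≠ d) : [a, b, c, d].Nodup := by simp [*]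

theorem marginEquiv_quadratic
    (hq : ∀ i i' j j' : α, [i, i', j, j'].Nodup → y (i, j) * y (i', j') = y (i, j') * y (i', j))
    {i i' j j' : α} (h : [i, i', j, j'].Nodup) (u : Multiset (α × α)) :
    MarginEquiv y ((i, j) ::ₘ (i', j') ::ₘ u) ((i, j') ::ₘ (i', j) ::ₘ u) := by
  have hp := hq i i' j j' h
  simp only [List.nodup_cons, List.mem_cons, List.not_mem_nil, or_false, not_or] at h
  refine ⟨by simp, ?_, fun k => ?_, ?_⟩
  · simp [Multiset.cons_swap]
  · simp only [Multiset.count_cons, Prod.mk.injEq]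
    grind
  · simp only [Multiset.map_cons, Multiset.prod_cons, ← mul_assoc, hp]

theorem marginEquiv_cubic
    (hc : ∀ i j k : α, [i, j, k].Nodup →
      y (i, j) * y (j, k) * y (k, i) = y (i, k) * y (k, j) * y (j, i))
    {i j k : α} (h : [i, j, k].Nodup) (u : Multiset (α × α)) :
    MarginEquiv y ((i, j) ::ₘ (j, k) ::ₘ (k, i) ::ₘ u) ((i, k) ::ₘ (k, j) ::ₘ (j, i) ::ₘ u) := by
  have hp := hc i j k h
  simp only [List.nodup_cons, List.mem_cons, List.not_mem_nil, or_false, not_or] at h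
  refine ⟨?_, ?_, fun k => ?_, ?_⟩
  · simp [Multiset.cons_swap]
  · simp only [Multiset.map_cons]
    rw [Multiset.cons_swap j k, Multiset.cons_swap j i]
  · simp only [Multiset.count_cons, Prod.mk.injEq]
    grind
  · simp only [Multiset.map_cons, Multiset.prod_cons, ← mul_assoc, hp]

/-- An off-diagonal cell cannot lie in both row `c` and column `c`, so it is counted at most once.
-/
theorem countP_add_countP_le_card (c : α) (s : Multiset (α × α)) (h : ∀ x ∈ s, x.1 ≠ x.2) :
    (s.map Prod.fst).count c + (s.map Prod.snd).count c ≤ s.card := by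
  induction s using Multiset.induction_on with
  | empty => simp
  | cons x s ih =>
    have := ih fun z hz => h z (Multiset.mem_cons_of_mem hz)
    have := h x (Multiset.mem_cons_self x s)
    simp only [Multiset.map_cons, Multiset.count_cons, Multiset.card_cons]
    grind

theorem card_le_countP_add_countP (c : α) (s : Multiset (α × α))
    (h : ∀ x ∈ s, x.1 = c ∨ x.2 = c) :
    s.card ≤ (s.map Prod.fst).count c + (s.map Prod.snd).count c := by
  induction s using Multiset.induction_on with
  | empty => simp
  | cons x s ih =>
    have := ih fun z hz => h z (Multiset.mem_cons_of_mem hz)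
    have := h x (Multiset.mem_cons_self x s)
    simp only [Multiset.map_cons, Multiset.count_cons, Multiset.card_cons]
    grind

/-- Given two off-diagonal tables with the same margins, the first can be changed by
quadratic and cubic moves so that it contains a prescribed cell of the second. -/
theorem exists_marginEquiv_cons
    (hq : ∀ i i' j j' : α, [i, i', j, j'].Nodup → y (i, j) * y (i', j') = y (i, j') * y (i', j))
    (hc : ∀ i j k : α, [i, j, k].Nodup →
      y (i, j) * y (j, k) * y (k, i) = y (i, k) * y (k, j) * y (j, i))
    {a b : α} {s t : Multiset (α × α)}
    (hs : ∀ x ∈ s, x.1 ≠ x.2) (ht : ∀ x ∈ (a, b) ::ₘ t, x.1 ≠ x.2)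
    (hr : s.map Prod.fst = ((a, b) ::ₘ t).map Prod.fst)
    (hl : s.map Prod.snd = ((a, b) ::ₘ t).map Prod.snd) :
    ∃ u, MarginEquiv y s ((a, b) ::ₘ u) := by
  have hab : a ≠ b := ht (a, b) (Multiset.mem_cons_self _ _)
  by_cases hm : (a, b) ∈ s
  · obtain ⟨u, rfl⟩ := Multiset.exists_cons_of_mem hm
    exact ⟨u, rfl, rfl, fun _ => rfl, rfl⟩
  -- One quadratic move turns `(a, d), (e, b)` into `(a, b), (e, d)`; `d ≠ e` keeps the latter off
  -- the diagonal.
  have key : ∀ d e, (a, d) ∈ s → (e, b) ∈ s → d ≠ e →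
      ∃ u, MarginEquiv y s ((a, b) ::ₘ u) := by
    intro d e h1 h2 hde
    have hd : a ≠ d := hs _ h1
    have he : e ≠ b := hs _ h2
    have hdb : d ≠ b := by rintro rfl; exact hm h1
    have hea : e ≠ a := by rintro rfl; exact hm h2
    obtain ⟨u, rfl⟩ := exists_eq_cons_cons h1 h2 (by simp [hea.symm])
    exact ⟨_, marginEquiv_quadratic hq (nodup_four hea.symm hd hab hde.symm he hdb) u⟩
  by_contra hcon
  obtain ⟨⟨a', c⟩, hac, rfl⟩ : ∃ x ∈ s, x.1 = a := by
    have : a ∈ s.map Prod.fst := by rw [hr]; simp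
    simpa only [Multiset.mem_map] using this
  obtain ⟨⟨c', b'⟩, hcb, rfl⟩ : ∃ x ∈ s, x.2 = b := by
    have : b ∈ s.map Prod.snd := by rw [hl]; simp
    simpa only [Multiset.mem_map] using this
  simp only at *
  -- If no move sequence works, row `a` of `s` lives only in column `c`, and column `b` only in row
  -- `c`.
  obtain rfl : c = c' := by
    by_contra hne
    exact hcon (key c c' hac hcb hne)
  have hrow : ∀ d, (a', d) ∈ s → d = c := fun d hd => by
    by_contra hne
    exact hcon (key d c hd hcb hne)
  have hcol : ∀ e, (e, b') ∈ s → e = c := fun e he => by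
    by_contra hne
    exact hcon (key c e hac he (Ne.symm hne))
  have hca : a' ≠ c := hs _ hac
  have hcb' : c ≠ b' := hs _ hcb
  have hba : (b', a') ∉ s := by
    intro hba
    obtain ⟨u, rfl⟩ := exists_eq_cons_cons_cons hac hcb hba (by simp [hca]) (by simp [hab])
      (by simp [hcb'])
    exact hcon ⟨_, marginEquiv_cubic hc (nodup_three hca hab hcb') u⟩
  -- A cell `(x, z)` avoiding row and column `c` serves as an intermediary: two quadratic moves then
  -- produce `(a, b)`.
  have hcross : ∀ x ∈ s, x.1 = c ∨ x.2 = c := by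
    rintro ⟨x, z⟩ hx
    by_contra! hne
    obtain ⟨hxc, hzc⟩ := hne
    simp only at hxc hzc
    have hxz : x ≠ z := hs _ hx
    have hxa : x ≠ a' := by rintro rfl; exact hzc (hrow z hx)
    have hzb : z ≠ b' := by rintro rfl; exact hxc (hcol x hx)
    obtain ⟨u, rfl⟩ := exists_eq_cons_cons_cons hac hcb hx (by simp [hca]) (by simp [hxa.symm])
      (by simp [hzb.symm])
    -- When `z = a'`, trading with `(a', c)` first would create the diagonal cell `(a', a')`, so
    -- `(c, b')` is used first.
    by_cases hza : z = a'
    · have hxb : x ≠ b' := by rintro rfl; subst hza; exact hba hx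
      have h1 := marginEquiv_quadratic hq (i := c) (i' := x) (j := b') (j' := z)
        (nodup_four (Ne.symm hxc) hcb' (Ne.symm hzc) hxb hxz hzb.symm) ((a', c) ::ₘ u)
      have h2 := marginEquiv_quadratic hq (i := a') (i' := x) (j := c) (j' := b')
        (nodup_four hxa.symm hca hab hxc hxb hcb') ((c, z) ::ₘ u)
      refine hcon ⟨_, MarginEquiv.trans ?_ h2⟩
      convert h1 using 1
      all_goals simp only [← Multiset.singleton_add]; abel
    · have h1 := marginEquiv_quadratic hq (i := a') (i' := x) (j := c) (j' := z)
        (nodup_four hxa.symm hca (Ne.symm hza) hxc hxz (Ne.symm hzc)) ((c, b') ::ₘ u)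
      have h2 := marginEquiv_quadratic hq (i := a') (i' := c) (j := z) (j' := b')
        (nodup_four hca (Ne.symm hza) hab (Ne.symm hzc) hcb' hzb) ((x, c) ::ₘ u)
      refine hcon ⟨_, MarginEquiv.trans ?_ h2⟩
      convert h1 using 1
      all_goals simp only [← Multiset.singleton_add]; abel
  -- Every cell of `s` meets row or column `c`, but `(a, b)` does not. So `t` alone carries both
  -- margins at `c`, whose sum is at least `t.card + 1`: too many for an off-diagonal table.
  have h1 := card_le_countP_add_countP c s hcross
  have h2 := countP_add_countP_le_card c t fun x hx => ht x (Multiset.mem_cons_of_mem hx)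
  have h3 : s.card = t.card + 1 := by simpa using congrArg Multiset.card hr
  rw [hr, hl] at h1
  simp only [Multiset.map_cons, Multiset.count_cons_of_ne hca.symm,
    Multiset.count_cons_of_ne hcb'] at h1
  omega

/-- Tables with the same margins and the same diagonal have the same product, for every family
that satisfies the quadratic and cubic relations. -/
theorem prod_map_eq_of_margins
    (hq : ∀ i i' j j' : α, [i, i', j, j'].Nodup → y (i, j) * y (i', j') = y (i, j') * y (i', j))
    (hc : ∀ i j k : α, [i, j, k].Nodup →
      y (i, j) * y (j, k) * y (k, i) = y (i, k) * y (k, j) * y (j, i))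
    (s t : Multiset (α × α)) (hr : s.map Prod.fst = t.map Prod.fst)
    (hl : s.map Prod.snd = t.map Prod.snd) (hd : ∀ i, s.count (i, i) = t.count (i, i)) :
    (s.map y).prod = (t.map y).prod := by
  induction hn : t.card generalizing s t with
  | zero =>
    obtain rfl : t = 0 := Multiset.card_eq_zero.1 hn
    obtain rfl : s = 0 := by simpa using hr
    rfl
  | succ m ih =>
    have cancel : ∀ (x : α × α) (s' t' : Multiset (α × α)), t = x ::ₘ t' →
        MarginEquiv y s (x ::ₘ s') → (s.map y).prod = (t.map y).prod := by
      rintro x s' t' rfl ⟨h1, h2, h3, h4⟩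
      rw [h4, Multiset.map_cons, Multiset.prod_cons, Multiset.map_cons, Multiset.prod_cons,
        ih s' t' (by simpa using h1.symm.trans hr) (by simpa using h2.symm.trans hl)
          (fun i => by simpa [Multiset.count_cons] using (h3 i).symm.trans (hd i))
          (by simpa using hn)]
    by_cases hdiag : ∃ i, (i, i) ∈ t
    · obtain ⟨i, hi⟩ := hdiag
      have his : (i, i) ∈ s := by
        rw [← Multiset.count_pos] at hi ⊢
        rwa [hd i]
      obtain ⟨t', rfl⟩ := Multiset.exists_cons_of_mem hi
      obtain ⟨s', rfl⟩ := Multiset.exists_cons_of_mem his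
      exact cancel _ s' t' rfl ⟨rfl, rfl, fun _ => rfl, rfl⟩
    · have ht : ∀ x ∈ t, x.1 ≠ x.2 := by
        rintro ⟨i, j⟩ hx (rfl : i = j)
        exact hdiag ⟨i, hx⟩
      have hs : ∀ x ∈ s, x.1 ≠ x.2 := by
        rintro ⟨i, j⟩ hx (rfl : i = j)
        refine hdiag ⟨i, ?_⟩
        rw [← Multiset.count_pos] at hx ⊢
        exact (hd i) ▸ hx
      obtain ⟨⟨a, b⟩, hx⟩ := Multiset.card_pos_iff_exists_mem.1 (by omega : 0 < t.card)
      obtain ⟨t', rfl⟩ := Multiset.exists_cons_of_mem hx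
      obtain ⟨s', hs'⟩ := exists_marginEquiv_cons hq hc hs ht hr hl
      exact cancel _ s' t' rfl hs'

end Exchange

/-! ### Toric ideals and their monomial fibres -/

section Toric

variable {C H : Type*} [Fintype H]

theorem powerProduct_eq_monomial (A : Matrix C H ℕ) (c : C) :
    powerProduct A c = monomial (Finsupp.equivFunOnFinite.symm (A c)) 1 := by
  rw [powerProduct, monomial_eq]
  simp [Finsupp.prod_fintype]

theorem aeval_powerProduct_monomial (A : Matrix C H ℕ) (u : C →₀ ℕ) :
    aeval (R := ℝ) (powerProduct A) (monomial u 1) =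
      monomial (u.sum fun c k => k • Finsupp.equivFunOnFinite.symm (A c)) 1 := by
  rw [aeval_monomial, map_one, one_mul, monomial_finsupp_sum_index, map_one, one_mul]
  simp only [powerProduct_eq_monomial, monomial_pow, one_pow]

/-- If all monomials in a fibre of the monomial map `A` agree modulo `J`, then `J` contains the
toric ideal. -/
theorem toricIdeal_le_of_monomial (A : Matrix C H ℕ) (J : Ideal (MvPolynomial C ℝ))
    (hJ : ∀ u v : C →₀ ℕ,
      (u.sum fun c k => k • Finsupp.equivFunOnFinite.symm (A c)) =
        (v.sum fun c k => k • Finsupp.equivFunOnFinite.symm (A c)) →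
      Ideal.Quotient.mk J (monomial u 1) = Ideal.Quotient.mk J (monomial v 1)) :
    toricIdeal A ≤ J := by
  classical
  let e : (C →₀ ℕ) → (H →₀ ℕ) := fun u => u.sum fun c k => k • Finsupp.equivFunOnFinite.symm (A c)
  -- `ψ` sends a monomial to the class of a chosen preimage, so that `ψ` after the substitution is
  -- the quotient map. Its values outside the range of `e` are irrelevant.
  let ψ : MvPolynomial H ℝ →ₗ[ℝ] (MvPolynomial C ℝ ⧸ J) :=
    (basisMonomials H ℝ).constr ℝ fun t =>
      Ideal.Quotient.mk J (monomial (Function.invFun e t) 1)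
  have hψ : ψ ∘ₗ (aeval (R := ℝ) (powerProduct A)).toLinearMap =
      (Ideal.Quotient.mkₐ ℝ J).toLinearMap := by
    refine (basisMonomials C ℝ).ext fun u => ?_
    have h1 : ψ (monomial (e u) 1) =
        Ideal.Quotient.mk J (monomial (Function.invFun e (e u)) 1) := by
      have := (basisMonomials H ℝ).constr_basis ℝ (fun t =>
        Ideal.Quotient.mk J (monomial (Function.invFun e t) 1)) (e u)
      rwa [coe_basisMonomials] at this
    simp only [coe_basisMonomials, LinearMap.comp_apply, AlgHom.toLinearMap_apply,
      aeval_powerProduct_monomial]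
    exact h1.trans (hJ _ _ (Function.invFun_eq (f := e) ⟨u, rfl⟩))
  intro f hf
  have hf' : aeval (R := ℝ) (powerProduct A) f = 0 := hf
  have := LinearMap.congr_fun hψ f
  simp only [LinearMap.comp_apply, AlgHom.toLinearMap_apply, hf', map_zero] at this
  exact Ideal.Quotient.eq_zero_iff_mem.1 this.symm

end Toric

theorem Multiset.sum_map_ite_one_zero {β : Type*} (p : β → Prop) [DecidablePred p]
    (s : Multiset β) : (s.map fun x => if p x then 1 else 0).sum = s.countP p := by
  induction s using Multiset.induction_on with
  | empty => simp
  | cons x s ih => simp [ih, Multiset.countP_cons, add_comm]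

theorem sum_smul_apply_eq_sum_map_toMultiset {C H : Type*} [Fintype H]
    (A : Matrix C H ℕ) (u : C →₀ ℕ) (h : H) :
    (u.sum fun c k => k • Finsupp.equivFunOnFinite.symm (A c)) h =
      ((Finsupp.toMultiset u).map fun c => A c h).sum := by
  induction u using Finsupp.induction_linear with
  | zero => simp
  | add u v hu hv =>
    rw [Finsupp.sum_add_index' (by simp) (by simp [add_smul]), Finsupp.add_apply, hu, hv]
    simp
  | single c k => simp [Finsupp.sum_single_index, Multiset.map_nsmul, Multiset.sum_nsmul]

theorem toricIdeal_diagonalEffectMatrix (n : ℕ) :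
    toricIdeal (diagonalEffectMatrix n) =
      Ideal.span (quadraticBinomials n ∪ cubicBinomials n) := by
  classical
  apply le_antisymm
  · set J := Ideal.span (quadraticBinomials n ∪ cubicBinomials n)
    refine toricIdeal_le_of_monomial _ _ fun u v huv => ?_
    have hX : ∀ w : (Fin n × Fin n) →₀ ℕ, ((Finsupp.toMultiset w).map X).prod =
        (monomial w 1 : MvPolynomial (Fin n × Fin n) ℝ) := by
      intro w
      induction w using Finsupp.induction_linear with
      | zero => simp
      | add u v hu hv => simp [hu, hv, monomial_mul]
      | single c k => simp [X_pow_eq_monomial, Multiset.map_nsmul, Multiset.prod_nsmul]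
    have hm : ∀ w : (Fin n × Fin n) →₀ ℕ, Ideal.Quotient.mk J (monomial w 1) =
        ((Finsupp.toMultiset w).map (Ideal.Quotient.mk J ∘ X)).prod := by
      intro w
      rw [← Multiset.map_map, ← map_multiset_prod, hX]
    have hA : ∀ h, ((Finsupp.toMultiset u).map fun c => diagonalEffectMatrix n c h).sum =
        ((Finsupp.toMultiset v).map fun c => diagonalEffectMatrix n c h).sum := fun h => by
      rw [← sum_smul_apply_eq_sum_map_toMultiset, huv, sum_smul_apply_eq_sum_map_toMultiset]
    rw [hm, hm]
    -- The family `y` is the classes of the variables modulo `J`.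
    apply prod_map_eq_of_margins
    · intro i i' j j' h
      simp only [Function.comp_apply]
      rw [← map_mul, ← map_mul, Ideal.Quotient.eq]
      exact Ideal.subset_span (Or.inl ⟨i, i', j, j', h, rfl⟩)
    · intro i j k h
      simp only [Function.comp_apply]
      rw [← map_mul, ← map_mul, ← map_mul, ← map_mul, Ideal.Quotient.eq]
      exact Ideal.subset_span (Or.inr ⟨i, j, k, h, rfl⟩)
    · ext k
      have := hA (Sum.inl k)
      simp only [diagonalEffectMatrix, Multiset.sum_map_ite_one_zero] at this
      simpa only [Multiset.count_map, Multiset.countP_eq_card_filter, eq_comm] using this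
    · ext k
      have := hA (Sum.inr (Sum.inl k))
      simp only [diagonalEffectMatrix, Multiset.sum_map_ite_one_zero] at this
      simpa only [Multiset.count_map, Multiset.countP_eq_card_filter, eq_comm] using this
    · intro k
      have := hA (Sum.inr (Sum.inr k))
      simp only [diagonalEffectMatrix, Multiset.sum_map_ite_one_zero] at this
      have hk : ∀ c : Fin n × Fin n, (c.1 = k ∧ c.2 = k) ↔ (k, k) = c := by grind
      simpa only [hk, Multiset.count] using this
  · have hX : ∀ i j : Fin n, i ≠ j → powerProduct (diagonalEffectMatrix n) (i, j) =
        X (Sum.inl i) * X (Sum.inr (Sum.inl j)) := by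
      intro i j hij
      have : ∀ k, ¬ (i = k ∧ j = k) := fun k h => hij (h.1.trans h.2.symm)
      simp [powerProduct, diagonalEffectMatrix, Fintype.prod_sum_type, this, pow_ite]
    rw [Ideal.span_le]
    rintro f (⟨i, i', j, j', h, rfl⟩ | ⟨i, j, k, h, rfl⟩)
    · simp only [List.nodup_cons, List.mem_cons, List.not_mem_nil, or_false, not_or] at h
      change aeval (R := ℝ) _ _ = 0
      simp only [map_sub, map_mul, aeval_X]
      rw [hX i j (by tauto), hX i' j' (by tauto), hX i j' (by tauto), hX i' j (by tauto)]
      ring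
    · simp only [List.nodup_cons, List.mem_cons, List.not_mem_nil, or_false, not_or] at h
      obtain ⟨⟨hij, hik⟩, hjk, -⟩ := h
      change aeval (R := ℝ) _ _ = 0
      simp only [map_sub, map_mul, aeval_X]
      rw [hX i j hij, hX j k hjk, hX k i (Ne.symm hik), hX i k hik, hX k j (Ne.symm hjk),
        hX j i (Ne.symm hij)]
      ring

/-! ### The vanishing ideal of the model -/

/-- A polynomial agrees, modulo `s - 1`, with a homogeneous polynomial, for every linear form
`s`. -/
theorem exists_isHomogeneous_sub_mem_span {σ : Type*} {s : MvPolynomial σ ℝ}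
    (hs : s.IsHomogeneous 1) (f : MvPolynomial σ ℝ) :
    ∃ (d : ℕ) (F : MvPolynomial σ ℝ), F.IsHomogeneous d ∧ f - F ∈ Ideal.span {s - 1} := by
  -- Each component is padded to the total degree by a power of `s`, which is `1` modulo `s - 1`.
  refine ⟨f.totalDegree, ∑ k ∈ Finset.range (f.totalDegree + 1),
    homogeneousComponent k f * s ^ (f.totalDegree - k), ?_, ?_⟩
  · refine IsHomogeneous.sum _ _ _ fun k hk => ?_
    have h := (homogeneousComponent_isHomogeneous k f).mul (hs.pow (f.totalDegree - k))
    rwa [one_mul, Nat.add_sub_cancel' (Nat.lt_succ_iff.1 (Finset.mem_range.1 hk))] at h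
  · have hf : f - ∑ k ∈ Finset.range (f.totalDegree + 1),
        homogeneousComponent k f * s ^ (f.totalDegree - k) =
        ∑ k ∈ Finset.range (f.totalDegree + 1),
          homogeneousComponent k f * -(s ^ (f.totalDegree - k) - 1) := by
      simp only [neg_sub, mul_sub, mul_one, Finset.sum_sub_distrib, sum_homogeneousComponent]
    rw [hf]
    refine Ideal.sum_mem _ fun k _ => Ideal.mul_mem_left _ _ (neg_mem ?_)
    rw [Ideal.mem_span_singleton]
    simpa using sub_dvd_pow_sub_pow s 1 (f.totalDegree - k)

theorem eval_smul_of_isHomogeneous {σ : Type*} {F : MvPolynomial σ ℝ} {d : ℕ}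
    (hF : F.IsHomogeneous d) (a : ℝ) (q : σ → ℝ) : eval (a • q) F = a ^ d * eval q F := by
  rw [eval_eq, eval_eq, Finset.mul_sum]
  refine Finset.sum_congr rfl fun u hu => ?_
  have hd : ∑ i ∈ u.support, u i = d := by
    rw [← hF (mem_support_iff.1 hu), Pi.one_def, ← Finsupp.degree_eq_weight_one]
    rfl
  simp only [Pi.smul_apply, smul_eq_mul, mul_pow, Finset.prod_mul_distrib,
    Finset.prod_pow_eq_pow_sum, hd]
  ring

theorem eval_powerProduct_diagonalEffectMatrix {n : ℕ} (ζ : DiagonalEffectParam n → ℝ)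
    (i j : Fin n) :
    eval ζ (powerProduct (diagonalEffectMatrix n) (i, j)) =
      ζ (Sum.inl i) * ζ (Sum.inr (Sum.inl j)) *
        if i = j then ζ (Sum.inr (Sum.inr i)) else 1 := by
  have h : ∀ k, (i = k ∧ j = k) ↔ (i = k ∧ i = j) := by
    intro k
    constructor <;> rintro ⟨rfl, rfl⟩ <;> simp
  by_cases hij : i = j <;>
    simp [powerProduct, diagonalEffectMatrix, Fintype.prod_sum_type, h, hij, pow_ite, mul_assoc]

theorem eval_aeval_powerProduct {C H : Type*} [Fintype H] (A : Matrix C H ℕ) (ζ : H → ℝ)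
    (f : MvPolynomial C ℝ) :
    eval ζ (aeval (R := ℝ) (powerProduct A) f) = eval (fun c => eval ζ (powerProduct A c)) f := by
  simpa only [aeval_eq_eval] using comp_aeval_apply (powerProduct A) (aeval ζ) f

theorem toricIdeal_le_vanishingIdeal (n : ℕ) :
    toricIdeal (diagonalEffectMatrix n) ≤ vanishingIdeal ℝ (diagonalEffectModel n) := by
  rintro f hf p ⟨-, r, c, γ, -, -, -, hoff, hdiag⟩
  have hf' : aeval (R := ℝ) (powerProduct (diagonalEffectMatrix n)) f = 0 := hf
  have h := eval_aeval_powerProduct (diagonalEffectMatrix n) (Sum.elim r (Sum.elim c γ)) f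
  have hp : (fun x => eval (Sum.elim r (Sum.elim c γ))
      (powerProduct (diagonalEffectMatrix n) x)) = p := by
    ext ⟨i, j⟩
    rw [eval_powerProduct_diagonalEffectMatrix]
    by_cases hij : i = j
    · subst hij
      simp [hdiag]
    · simp [hij, hoff i j hij]
  rw [hf', map_zero, hp] at h
  rw [aeval_eq_eval]
  exact h.symm

/-- The normalization of a table with positive parameters lies in the diagonal-effect model. -/
theorem normalize_mem_diagonalEffectModel {n : ℕ} [NeZero n] {ζ : DiagonalEffectParam n → ℝ}
    (hζ : ∀ h, 0 < ζ h) {p : Fin n × Fin n → ℝ}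
    (hp : p = fun x => eval ζ (powerProduct (diagonalEffectMatrix n) x)) :
    0 < ∑ x, p x ∧ (fun x => (∑ x, p x)⁻¹ * p x) ∈ diagonalEffectModel n := by
  have hpos : ∀ x, 0 < p x := by
    rintro ⟨i, j⟩
    simp only [hp, eval_powerProduct_diagonalEffectMatrix]
    have := hζ (Sum.inl i)
    have := hζ (Sum.inr (Sum.inl j))
    have := hζ (Sum.inr (Sum.inr i))
    split_ifs <;> positivity
  have hS : 0 < ∑ x, p x := Finset.sum_pos (fun x _ => hpos x) Finset.univ_nonempty
  refine ⟨hS, ⟨fun x => (mul_pos (inv_pos.2 hS) (hpos x)).le, ?_⟩,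
    -- Each cell is linear in its row parameter, which can absorb the scaling.
    fun i => (∑ x, p x)⁻¹ * ζ (Sum.inl i), fun j => ζ (Sum.inr (Sum.inl j)),
    fun i => ζ (Sum.inr (Sum.inr i)), fun i => (mul_pos (inv_pos.2 hS) (hζ _)).le,
    fun j => (hζ _).le, fun i => (hζ _).le, fun i j hij => ?_, fun i => ?_⟩
  · rw [← Finset.mul_sum, inv_mul_cancel₀ hS.ne']
  · have : p (i, j) = ζ (Sum.inl i) * ζ (Sum.inr (Sum.inl j)) := by
      simp [hp, eval_powerProduct_diagonalEffectMatrix, hij]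
    simp only [this, mul_assoc]
  · have : p (i, i) = ζ (Sum.inl i) * ζ (Sum.inr (Sum.inl i)) * ζ (Sum.inr (Sum.inr i)) := by
      simp [hp, eval_powerProduct_diagonalEffectMatrix]
    simp only [this, mul_assoc]

theorem vanishingIdeal_diagonalEffectModel (n : ℕ) :
    vanishingIdeal ℝ (diagonalEffectModel n) =
      toricIdeal (diagonalEffectMatrix n) ⊔
        Ideal.span {∑ c : Fin n × Fin n, X c - 1} := by
  apply le_antisymm
  · intro f hf
    -- For `n = 0` the model is empty and the normalization reads `-1`, so both ideals are the whole
    -- ring.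
    obtain rfl | hn := eq_or_ne n 0
    · have h : (-1 : MvPolynomial (Fin 0 × Fin 0) ℝ) ∈
          Ideal.span {∑ c : Fin 0 × Fin 0, (X c : MvPolynomial (Fin 0 × Fin 0) ℝ) - 1} :=
        Ideal.subset_span (by simp)
      have h' := neg_mem h
      rw [neg_neg] at h'
      rw [(Ideal.eq_top_iff_one _).2 h']
      simp
    have : NeZero n := ⟨hn⟩
    obtain ⟨d, F, hF, hfF⟩ := exists_isHomogeneous_sub_mem_span
      (IsHomogeneous.sum Finset.univ (X (R := ℝ)) 1
        fun (c : Fin n × Fin n) _ => isHomogeneous_X ℝ c) f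
    rw [← add_sub_cancel F f]
    refine add_mem (Ideal.mem_sup_left ?_) (Ideal.mem_sup_right hfF)
    change aeval (R := ℝ) _ _ = 0
    -- A polynomial vanishing on the positive orthant, a product of infinite sets, is zero.
    refine funext_set (fun _ => Set.Ioi (0 : ℝ)) (fun _ => Set.Ioi_infinite 0) fun ζ hζ => ?_
    rw [eval_aeval_powerProduct, map_zero]
    generalize hp : (fun x => eval ζ (powerProduct (diagonalEffectMatrix n) x)) = p
    obtain ⟨hS, hq⟩ := normalize_mem_diagonalEffectModel (fun h => hζ h trivial) hp.symm
    set q := fun x => (∑ x, p x)⁻¹ * p x with hq_def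
    have hfq : eval q f = 0 := hf q hq
    have hFq : eval q F = 0 := by
      obtain ⟨g, hg⟩ := Ideal.mem_span_singleton.1 hfF
      have h := congrArg (eval q) hg
      have hsum : ∑ x, q x = 1 := hq.1.2
      simpa [hfq, hsum] using h
    have hpq : p = (∑ x, p x) • q := by
      ext x
      simp [hq_def, hS.ne']
    rw [hpq, eval_smul_of_isHomogeneous hF, hFq, mul_zero]
  · refine sup_le (toricIdeal_le_vanishingIdeal n) ?_
    rw [Ideal.span_singleton_le_iff_mem]
    rintro p ⟨hp, -⟩
    simp [hp.2]

theorem proposition3p2 (n : ℕ) :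
    toricIdeal (diagonalEffectMatrix n) =
        Ideal.span (quadraticBinomials n ∪ cubicBinomials n) ∧
      MvPolynomial.vanishingIdeal ℝ (diagonalEffectModel n) =
        Ideal.span (quadraticBinomials n ∪ cubicBinomials n ∪
          {∑ c : Fin n × Fin n, MvPolynomial.X c - 1}) := by
  refine ⟨toricIdeal_diagonalEffectMatrix n, ?_⟩
  rw [vanishingIdeal_diagonalEffectModel, toricIdeal_diagonalEffectMatrix, ← Ideal.span_union]
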